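/- **Theorem 4.2 (never falling pendulum).** For $f:\mathbb R^3\to\mathbb R$, a generalized solution of $\ddot x=f(t,x,\dot x)$ on $\mathbb R$ is a function $x\in C^1(\mathbb R)$ such that $\dot x$ is locally absolutely continuous and, for almost every $t\in\mathbb R$, $$\ddot x(t)\in\bigcap_{r>0}\ \bigcap_{\mu(N)=0}\overline{\mathrm{co}}\; f\bigl(t,x(t),B_r(\dot x(t))\setminus N\bigr),$$ where $\mu$ is Lebesgue measure on $\mathbb R$, $N\subset\mathbb R$ runs over all $\mu$-null sets, $B_r(y)=(y-r,y+r)$ and $\overline{\mathrm{co}}$ is the closed convex hull. Let $\omega\in C^1(\mathbb R)$, let $t_0\in\mathbb R$, and put $\Phi(t)=\int_{t_0}^t\omega(\xi)\,d\xi$. Let $K\in C^2(\mathbb R)$ be $2\pi$-periodic with $0\le K(\psi)\le K^*$ for all $\psi\in\mathbb R$. Suppose that $\Phi^*,\varepsilon\in\mathbb R$ are constants with $|\Phi(t)|\le\Phi^*$ and $|\dot\omega(t)|\le\varepsilon$ for all $t\in\mathbb R$. Suppose that there is a constant $\psi^*\ge0$ such that $$\psi^*+\Phi^*\le\frac{\pi}{2},\qquad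 \sin(\psi^*-\Phi^*)>K^*+\varepsilon.$$ Then the equation $$\ddot\psi=\sin\bigl(\psi+\Phi(t)\bigr)-K(\psi)\frac{\dot\psi}{|\dot\psi|}-\dot\omega(t)$$ of a pendulum with Coulomb friction against a wheel rotating with angular velocity $\omega$ has a generalized solution $\psi$ on all of $\mathbb R$ such that $|\psi(t)|\le\psi^*$ for all $t\in\mathbb R$. In particular, the pendulum angle $\varphi=\psi+\Phi$ satisfies $|\varphi(t)|\le\psi^*+\Phi^*\le\pi/2$ for all $t\in\mathbb R$: the pendulum never falls. -/

import Mathlib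

open MeasureTheory Set Real

/-- The set `⋂_{r > 0} ⋂_{μ(N) = 0} conv f(t, x, B_r(v) \ N)`, where `conv` is the closed convex
hull, `B_r(v)` the open ball and `N` ranges over all (Lebesgue-)null sets of velocities. -/
def filippovSet {E : Type*} [NormedAddCommGroup E] [NormedSpace ℝ E] [MeasureSpace E]
    (f : ℝ → E → E → E) (t : ℝ) (x v : E) : Set E :=
  ⋂ r : ℝ, ⋂ _ : 0 < r, ⋂ N : Set E, ⋂ _ : volume N = 0,
    closedConvexHull ℝ (f t x '' (Metric.ball v r \ N))

/-- `x` is a generalized solution of `x'' = f(t, x, x')` on the open interval `J`: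
`x` is `C¹` on `J`, `x'` is (locally) absolutely continuous in `J`, and for almost every `t ∈ J`
the second derivative exists and lies in `filippovSet f t (x t) (x' t)`. -/
structure IsGeneralizedSolution {E : Type*} [NormedAddCommGroup E] [NormedSpace ℝ E]
    [MeasureSpace E] (f : ℝ → E → E → E) (J : Set ℝ) (x : ℝ → E) : Prop where
  isOpen : IsOpen J
  ordConnected : J.OrdConnected
  contDiffOn : ContDiffOn ℝ 1 x J
  absolutelyContinuous : ∀ a b : ℝ, uIcc a b ⊆ J → AbsolutelyContinuousOnInterval (deriv x) a b
  inclusion : ∀ᵐ t ∂(volume : Measure ℝ), t ∈ J →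
    ∃ a : E, HasDerivAt (deriv x) a t ∧ a ∈ filippovSet f t (x t) (deriv x t)

/-- The angle `Φ(t) = ∫_{t₀}^t ω(ξ) dξ` of a wheel with angular velocity `ω`. -/
noncomputable def wheelAngle (ω : ℝ → ℝ) (t₀ t : ℝ) : ℝ := ∫ ξ in t₀..t, ω ξ

/-- The right-hand side of `ψ'' = sin (ψ + Φ(t)) - K(ψ) ψ' / |ψ'| - ω'(t)`, as a function of
`(t, ψ, ψ')`. The value taken at `ψ' = 0` does not affect generalized solutions, because
`{0}` is a null set of velocities. -/
noncomputable def pendulumForce (ω : ℝ → ℝ) (t₀ : ℝ) (K : ℝ → ℝ) (t ψ v : ℝ) : ℝ :=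
  sin (ψ + wheelAngle ω t₀ t) - K ψ * (v / |v|) - deriv ω t

open Filter Topology

/-! Replace the sign of the velocity by the ramp `clamp 1 (k * v)` and the position by its
truncation to `[-ψstar, ψstar]`. The force becomes bounded and Lipschitz, so the Dirichlet problem
with zero boundary values on `[-T, T]` is solvable by shooting (`exists_dirichlet_solution`). The
ramp vanishes at zero velocity, and at or beyond `±ψstar` gravity beats the wheel's acceleration and
points outwards. Hence no maximum above `ψstar` and no minimum below `-ψstar` can occur
(`le_of_deriv_pos_at_critical`), and the position truncation is inactive.

With `k = n` and `T = n + 2`, position, velocity and acceleration are bounded uniformly in `n`; an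
ultrafilter limit is `C¹` with Lipschitz velocity (`exists_ultrafilter_limit_of_bounded`). Where
that velocity is differentiable, `abs_deriv_sub_le_of_tendsto` puts its derivative in the Filippov
set. -/

/-- Truncation of `y` to the interval `[-c, c]`. -/
noncomputable def clamp (c y : ℝ) : ℝ := max (-c) (min c y)

theorem abs_clamp_le {c : ℝ} (hc : 0 ≤ c) (y : ℝ) : |clamp c y| ≤ c :=
  abs_le.2 ⟨le_max_left _ _, max_le (by linarith) (min_le_left _ _)⟩

theorem abs_clamp_sub_clamp_le (c y z : ℝ) : |clamp c y - clamp c z| ≤ |y - z| := by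
  unfold clamp
  rw [max_comm, max_comm (-c), min_comm, min_comm c]
  exact (abs_max_sub_max_le_abs _ _ _).trans (abs_min_sub_min_le_max _ _ _ _ |>.trans (by simp))

theorem clamp_of_abs_le {c y : ℝ} (h : |y| ≤ c) : clamp c y = y := by
  rw [clamp, min_eq_right (abs_le.1 h).2, max_eq_right (abs_le.1 h).1]

theorem clamp_of_le {c y : ℝ} (hc : 0 ≤ c) (h : c ≤ y) : clamp c y = c := by
  rw [clamp, min_eq_left h, max_eq_right (by linarith)]

theorem clamp_of_le_neg {c y : ℝ} (hc : 0 ≤ c) (h : y ≤ -c) : clamp c y = -c := by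
  rw [clamp, min_eq_right (by linarith), max_eq_left h]

/-! ### Dirichlet problem by shooting -/

/-- Over time `2T` the velocity changes by at most `2CT < V`. Initial slopes `±V` therefore keep the
sign of the velocity, the endpoint values have opposite signs, and some slope between hits zero. No
speed exceeds `M = V + 2CT`, so truncating the velocity there bounds the field without changing
these solutions. -/
theorem exists_dirichlet_solution {f : ℝ → ℝ → ℝ → ℝ} {C L T : ℝ} (hT : 0 < T) (hL : 0 ≤ L)
    (hbound : ∀ t x v, |f t x v| ≤ C) (hcont : ∀ x v, Continuous fun t => f t x v)
    (hlip : ∀ t x y v w, |f t x v - f t y w| ≤ L * (|x - y| + |v - w|)) :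
    ∃ x v : ℝ → ℝ, x (-T) = 0 ∧ x T = 0 ∧ ContinuousOn x (Icc (-T) T) ∧
      ∀ t ∈ Ioo (-T) T, HasDerivAt x (v t) t ∧ HasDerivAt v (f t (x t) (v t)) t := by
  have hC : 0 ≤ C := (abs_nonneg _).trans (hbound 0 0 0)
  have hCT : 0 ≤ C * T := by positivity
  obtain ⟨V, hV⟩ : ∃ V, V = 2 * (C * T) + 1 := ⟨_, rfl⟩
  obtain ⟨M, hM⟩ : ∃ M, M = V + 2 * (C * T) := ⟨_, rfl⟩
  have hV0 : 0 < V := by linarith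
  have hM0 : 0 < M := by linarith
  let F : ℝ → ℝ × ℝ → ℝ × ℝ := fun t p => (clamp M p.2, f t p.1 p.2)
  have hmem : -T ∈ Icc (-T) T := ⟨le_rfl, by linarith⟩
  -- The field has norm at most `M + C`, so data in the ball of radius `V` travel at most `(M + C) *
  -- 2T`; one flow then serves all slopes on the whole interval.
  have hPL : IsPicardLindelof F (⟨-T, hmem⟩ : Icc (-T) T) (0 : ℝ × ℝ)
      (V + (M + C) * (2 * T)).toNNReal V.toNNReal (M + C).toNNReal (1 + 2 * L).toNNReal := by
    refine ⟨fun t _ => ?_, fun p _ => ?_, fun t _ p _ => ?_, ?_⟩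
    · refine LipschitzOnWith.of_dist_le_mul fun p _ q _ => ?_
      rw [Real.coe_toNNReal _ (by positivity), dist_eq_norm, dist_eq_norm]
      have h1 : |p.1 - q.1| ≤ ‖p - q‖ := norm_fst_le (p - q)
      have h2 : |p.2 - q.2| ≤ ‖p - q‖ := norm_snd_le (p - q)
      refine (max_le ?_ ?_ : ‖F t p - F t q‖ ≤ _)
      · have h3 : ‖(F t p - F t q).1‖ ≤ |p.2 - q.2| := abs_clamp_sub_clamp_le _ _ _
        nlinarith [norm_nonneg (p - q)]
      · have h3 : ‖(F t p - F t q).2‖ ≤ L * (|p.1 - q.1| + |p.2 - q.2|) := hlip t _ _ _ _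
        nlinarith [norm_nonneg (p - q)]
    · exact (continuous_const.prodMk (hcont _ _)).continuousOn
    · rw [Real.coe_toNNReal _ (by positivity)]
      refine (max_le ?_ ?_ : ‖F t p‖ ≤ _)
      · exact (abs_clamp_le hM0.le _).trans (by linarith)
      · exact (hbound _ _ _).trans (by linarith)
    · rw [Real.coe_toNNReal _ (by positivity), Real.coe_toNNReal _ (by positivity),
        Real.coe_toNNReal _ (by positivity), max_eq_left (by simp; linarith)]
      linarith
  obtain ⟨α, hα, L', hα'⟩ := hPL.exists_forall_mem_closedBall_eq_hasDerivWithinAt_lipschitzOnWith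
  rw [Real.coe_toNNReal _ hV0.le] at hα hα'
  have hball : ∀ s ∈ Icc (-V) V, ((0 : ℝ), s) ∈ Metric.closedBall (0 : ℝ × ℝ) V := fun s hs => by
    rw [mem_closedBall_zero_iff]
    exact max_le (by simpa using hV0.le) (abs_le.2 hs)
  have hα1 : ∀ s ∈ Icc (-V) V, ∀ t ∈ Icc (-T) T, HasDerivWithinAt (fun t => (α (0, s) t).1)
      (clamp M (α (0, s) t).2) (Icc (-T) T) t := fun s hs t ht =>
    (hasFDerivAt_fst (𝕜 := ℝ) (p := α (0, s) t)).comp_hasDerivWithinAt t ((hα _ (hball s hs)).2 t ht)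
  have hα2 : ∀ s ∈ Icc (-V) V, ∀ t ∈ Icc (-T) T, HasDerivWithinAt (fun t => (α (0, s) t).2)
      (f t (α (0, s) t).1 (α (0, s) t).2) (Icc (-T) T) t := fun s hs t ht =>
    (hasFDerivAt_snd (𝕜 := ℝ) (p := α (0, s) t)).comp_hasDerivWithinAt t ((hα _ (hball s hs)).2 t ht)
  have hv : ∀ s ∈ Icc (-V) V, ∀ t ∈ Icc (-T) T, |(α (0, s) t).2 - s| ≤ 2 * (C * T) := by
    intro s hs t ht
    have h := (convex_Icc (-T) T).norm_image_sub_le_of_norm_hasDerivWithin_le (hα2 s hs)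
      (fun t _ => hbound _ _ _) hmem ht
    have h0 : α (0, s) (-T) = (0, s) := (hα _ (hball s hs)).1
    simp only [h0, Real.norm_eq_abs] at h
    have : |t - -T| ≤ 2 * T := abs_le.2 ⟨by linarith [ht.1], by linarith [ht.2]⟩
    nlinarith
  have hx0 : ∀ s ∈ Icc (-V) V, (α (0, s) (-T)).1 = 0 := fun s hs => by
    rw [show α (0, s) (-T) = (0, s) from (hα _ (hball s hs)).1]
  have hTmem : T ∈ Icc (-T) T := ⟨by linarith, le_rfl⟩
  have hpos : 0 ≤ (α (0, V) T).1 := by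
    have hs : V ∈ Icc (-V) V := ⟨by linarith, le_rfl⟩
    have hmono : MonotoneOn (fun t => (α (0, V) t).1) (Icc (-T) T) :=
      monotoneOn_of_hasDerivWithinAt_nonneg (convex_Icc _ _)
        (fun t ht => (hα1 V hs t ht).continuousWithinAt)
        (fun t ht => (hα1 V hs t (interior_subset ht)).mono interior_subset) fun t ht => by
          have := abs_le.1 (hv V hs t (interior_subset ht))
          exact le_max_of_le_right (le_min hM0.le (by linarith))
    have := hmono hmem hTmem (by linarith)
    simpa only [hx0 V hs] using this
  have hneg : (α (0, -V) T).1 ≤ 0 := by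
    have hs : -V ∈ Icc (-V) V := ⟨le_rfl, by linarith⟩
    have hanti : AntitoneOn (fun t => (α (0, -V) t).1) (Icc (-T) T) :=
      antitoneOn_of_hasDerivWithinAt_nonpos (convex_Icc _ _)
        (fun t ht => (hα1 _ hs t ht).continuousWithinAt)
        (fun t ht => (hα1 _ hs t (interior_subset ht)).mono interior_subset) fun t ht => by
          have := abs_le.1 (hv _ hs t (interior_subset ht))
          exact max_le (by linarith) (min_le_of_right_le (by linarith))
    have := hanti hmem hTmem (by linarith)
    simpa only [hx0 _ hs] using this
  have hcs : ContinuousOn (fun s : ℝ => (α (0, s) T).1) (Icc (-V) V) :=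
    continuous_fst.comp_continuousOn
      ((hα' T hTmem).continuousOn.comp (by fun_prop) hball)
  obtain ⟨s, hs, hsT⟩ := intermediate_value_Icc (by linarith) hcs ⟨hneg, hpos⟩
  refine ⟨fun t => (α (0, s) t).1, fun t => (α (0, s) t).2, hx0 s hs, hsT,
    fun t ht => (hα1 s hs t ht).continuousWithinAt, fun t ht => ?_⟩
  have hn : Icc (-T) T ∈ 𝓝 t := Icc_mem_nhds ht.1 ht.2
  have ht' := Ioo_subset_Icc_self ht
  refine ⟨?_, (hα2 s hs t ht').hasDerivAt hn⟩
  have h := (hα1 s hs t ht').hasDerivAt hn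
  have hb := abs_le.1 (hv s hs t ht')
  rwa [clamp_of_abs_le (abs_le.2 ⟨by linarith [hs.1], by linarith [hs.2]⟩)] at h

/-! ### A priori bounds -/

/-- The zero boundary values make a maximum above `M` interior; there `v = 0 < a`, so `v > 0` just
to the right and `x` would still increase. -/
theorem le_of_deriv_pos_at_critical {x v a : ℝ → ℝ} {T M : ℝ} (hM : 0 ≤ M)
    (h0 : x (-T) = 0) (h1 : x T = 0) (hx : ContinuousOn x (Icc (-T) T))
    (hd : ∀ t ∈ Ioo (-T) T, HasDerivAt x (v t) t ∧ HasDerivAt v (a t) t)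
    (hpos : ∀ t ∈ Ioo (-T) T, M < x t → v t = 0 → 0 < a t) :
    ∀ t ∈ Icc (-T) T, x t ≤ M := by
  by_contra! ⟨s, hs, hMs⟩
  obtain ⟨t, ht, hmax⟩ := isCompact_Icc.exists_isMaxOn ⟨s, hs⟩ hx
  have hMt : M < x t := hMs.trans_le (hmax hs)
  have ht' : t ∈ Ioo (-T) T := by
    refine ⟨lt_of_le_of_ne ht.1 ?_, lt_of_le_of_ne ht.2 ?_⟩ <;> rintro rfl <;> linarith
  have hlm : IsLocalMax x t := hmax.isLocalMax (Icc_mem_nhds ht'.1 ht'.2)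
  have hvt : v t = 0 := hlm.hasDerivAt_eq_zero (hd t ht').1
  have ha := hpos t ht' hMt hvt
  have hev : ∀ᶠ s in 𝓝[>] t, 0 < v s := by
    have := (hasDerivAt_iff_tendsto_slope.1 (hd t ht').2).mono_left
      (nhdsWithin_mono t fun s (hs : t < s) => hs.ne')
    filter_upwards [this.eventually_const_lt ha, self_mem_nhdsWithin] with s hs hts
    rw [slope_def_field, hvt, sub_zero] at hs
    exact (div_pos_iff_of_pos_right (sub_pos.2 hts)).1 hs
  obtain ⟨u, hu, hsub⟩ := (mem_nhdsGT_iff_exists_Ioo_subset' ht'.2).1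
    (inter_mem hev (Ioo_mem_nhdsGT ht'.2))
  obtain ⟨s, hts, hsu⟩ := exists_between (show t < u from hu)
  have hsT : s < T := (hsub ⟨hts, hsu⟩).2.2
  obtain ⟨r, hr, hslope⟩ := exists_hasDerivAt_eq_slope x v hts
    (hx.mono (Icc_subset_Icc ht.1 hsT.le))
    fun r hr => (hd r ⟨ht'.1.trans hr.1, hr.2.trans hsT⟩).1
  have hvr : 0 < v r := (hsub ⟨hr.1, hr.2.trans hsu⟩).1
  rw [hslope, div_pos_iff_of_pos_right (sub_pos.2 hts)] at hvr
  have : x s ≤ x t := hmax ⟨(ht'.1.trans hts).le, hsT.le⟩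
  linarith

/-- Since `T > 1`, some unit interval around `t` fits in the domain. The mean value theorem gives a
point in it with speed at most `2M`, and moving to `t` costs at most `C`. -/
theorem abs_deriv_le_of_abs_le {x v a : ℝ → ℝ} {T M C : ℝ} (hT : 1 < T)
    (hd : ∀ t ∈ Ioo (-T) T, HasDerivAt x (v t) t ∧ HasDerivAt v (a t) t)
    (hx : ∀ t ∈ Ioo (-T) T, |x t| ≤ M) (ha : ∀ t ∈ Ioo (-T) T, |a t| ≤ C) :
    ∀ t ∈ Ioo (-T) T, |v t| ≤ 2 * M + C := by
  intro t ht
  obtain ⟨b, hb1, hb2, htb⟩ : ∃ b, -T < b ∧ b + 1 < T ∧ t ∈ Icc b (b + 1) := by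
    rcases le_total t 0 with h | h
    · exact ⟨t, ht.1, by linarith, le_rfl, by linarith⟩
    · exact ⟨t - 1, by linarith, by linarith [ht.2], by linarith, by linarith⟩
  have hsub : Icc b (b + 1) ⊆ Ioo (-T) T := fun s hs => ⟨hb1.trans_le hs.1, hs.2.trans_lt hb2⟩
  obtain ⟨r, hr, hslope⟩ := exists_hasDerivAt_eq_slope x v (lt_add_one b)
    (fun s hs => (hd s (hsub hs)).1.continuousAt.continuousWithinAt)
    fun s hs => (hd s (hsub (Ioo_subset_Icc_self hs))).1
  have hr' := Ioo_subset_Icc_self hr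
  have h := (convex_Icc b (b + 1)).norm_image_sub_le_of_norm_hasDerivWithin_le
    (fun s hs => (hd s (hsub hs)).2.hasDerivWithinAt) (fun s hs => ha s (hsub hs)) hr' htb
  simp only [Real.norm_eq_abs] at h
  have h2 : |t - r| ≤ 1 := abs_le.2 ⟨by linarith [htb.1, hr.2], by linarith [htb.2, hr.1]⟩
  have hC : 0 ≤ C := (abs_nonneg _).trans (ha t ht)
  have h3 := abs_le.1 (h.trans (mul_le_of_le_one_right hC h2))
  have h4 := abs_le.1 (hx b (hsub (left_mem_Icc.2 (by linarith))))
  have h5 := abs_le.1 (hx (b + 1) (hsub (right_mem_Icc.2 (by linarith))))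
  rw [add_sub_cancel_left, div_one] at hslope
  exact abs_le.2 ⟨by linarith, by linarith⟩

/-! ### Limits along an ultrafilter -/

theorem eventually_Icc_subset_Ioo_natCast (t : ℝ) :
    ∀ᶠ n : ℕ in atTop, Icc (t - 1) (t + 1) ⊆ Ioo (-(n + 2 : ℝ)) (n + 2) := by
  filter_upwards [eventually_ge_atTop ⌈|t|⌉₊] with n hn s hs
  have h := abs_le.1 (Nat.ceil_le.1 hn)
  exact ⟨by linarith [hs.1, h.1], by linarith [hs.2, h.2]⟩

theorem Ultrafilter.exists_tendsto_of_eventually_abs_le {ι : Type*} (U : Ultrafilter ι)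
    {u : ι → ℝ} {M : ℝ} (h : ∀ᶠ n in U, |u n| ≤ M) :
    ∃ l, Tendsto u U (𝓝 l) := by
  obtain ⟨l, -, hl⟩ := isCompact_Icc.ultrafilter_le_nhds (U.map u) (s := Icc (-M) M)
    (le_principal_iff.2 (h.mono fun n hn => abs_le.1 hn))
  exact ⟨l, hl⟩

/-- An ultrafilter gives pointwise limits at every `t` at once, in place of Arzelà–Ascoli with a
diagonal sequence. The Lipschitz bound on velocities and a quadratic Taylor remainder, both uniform
in `n`, survive the limit; the latter yields `X' = W`. -/
theorem exists_ultrafilter_limit_of_bounded {x v a : ℕ → ℝ → ℝ} {M V C : ℝ}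
    (hd : ∀ n : ℕ, ∀ t ∈ Ioo (-(n + 2 : ℝ)) (n + 2),
      HasDerivAt (x n) (v n t) t ∧ HasDerivAt (v n) (a n t) t)
    (hx : ∀ n : ℕ, ∀ t ∈ Ioo (-(n + 2 : ℝ)) (n + 2), |x n t| ≤ M)
    (hv : ∀ n : ℕ, ∀ t ∈ Ioo (-(n + 2 : ℝ)) (n + 2), |v n t| ≤ V)
    (ha : ∀ n : ℕ, ∀ t ∈ Ioo (-(n + 2 : ℝ)) (n + 2), |a n t| ≤ C) :
    ∃ (U : Ultrafilter ℕ) (X W : ℝ → ℝ), (U : Filter ℕ) ≤ atTop ∧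
      (∀ t, Tendsto (x · t) U (𝓝 (X t))) ∧ (∀ t, Tendsto (v · t) U (𝓝 (W t))) ∧
      (∀ t, HasDerivAt X (W t) t) ∧ LipschitzWith C.toNNReal W ∧ ∀ t, |X t| ≤ M := by
  obtain ⟨U, hU⟩ := Ultrafilter.exists_le (atTop : Filter ℕ)
  have hdom : ∀ s t : ℝ, ∀ᶠ n : ℕ in U, uIcc s t ⊆ Ioo (-(n + 2 : ℝ)) (n + 2) := by
    intro s t
    filter_upwards [hU (eventually_Icc_subset_Ioo_natCast s),
      hU (eventually_Icc_subset_Ioo_natCast t)] with n hs ht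
    exact ordConnected_Ioo.uIcc_subset (hs ⟨by linarith, by linarith⟩)
      (ht ⟨by linarith, by linarith⟩)
  have hC : 0 ≤ C := (abs_nonneg _).trans (ha 0 0 (by norm_num))
  choose X hX using fun t => U.exists_tendsto_of_eventually_abs_le
    ((hdom t t).mono fun n hn => hx n t (hn left_mem_uIcc))
  choose W hW using fun t => U.exists_tendsto_of_eventually_abs_le
    ((hdom t t).mono fun n hn => hv n t (hn left_mem_uIcc))
  have hlip : ∀ (n : ℕ) (s t : ℝ), uIcc s t ⊆ Ioo (-(n + 2 : ℝ)) (n + 2) →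
      |v n t - v n s| ≤ C * |t - s| := fun n s t hn =>
    (convex_uIcc s t).norm_image_sub_le_of_norm_hasDerivWithin_le
      (fun r hr => (hd n r (hn hr)).2.hasDerivWithinAt) (fun r hr => ha n r (hn hr))
      left_mem_uIcc right_mem_uIcc
  have htaylor : ∀ s t, |X t - X s - W s * (t - s)| ≤ C * |t - s| * |t - s| := by
    intro s t
    refine le_of_tendsto (((hX t).sub (hX s)).sub ((hW s).mul_const (t - s))).abs ?_
    filter_upwards [hdom s t] with n hn
    have h := (convex_uIcc s t).norm_image_sub_le_of_norm_hasDerivWithin_le (C := C * |t - s|)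
      (f := fun r => x n r - v n s * r) (f' := fun r => v n r - v n s)
      (fun r hr => ((hd n r (hn hr)).1.sub
        ((hasDerivAt_id r).const_mul (v n s))).hasDerivWithinAt.congr_deriv (by simp))
      (fun r hr => (hlip n s r ((uIcc_subset_uIcc_left hr).trans hn)).trans
        (mul_le_mul_of_nonneg_left (abs_sub_left_of_mem_uIcc hr) hC))
      left_mem_uIcc right_mem_uIcc
    simp only [Real.norm_eq_abs] at h
    exact (le_of_eq (congrArg abs (by ring))).trans h
  refine ⟨U, X, W, hU, hX, hW, fun t => ?_, ?_, fun t => ?_⟩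
  · rw [hasDerivAt_iff_isLittleO]
    refine Asymptotics.IsBigO.trans_isLittleO (g := fun s => (s - t) ^ 2) ?_ ?_
    · refine Asymptotics.IsBigO.of_bound C (Eventually.of_forall fun s => ?_)
      rw [Real.norm_eq_abs, Real.norm_eq_abs, abs_pow, smul_eq_mul, mul_comm (s - t)]
      exact (htaylor t s).trans_eq (by ring)
    · have h : Tendsto (fun s : ℝ => s - t) (𝓝 t) (𝓝 0) := by
        simpa using (continuous_sub_right t).tendsto t
      simpa [Function.comp_def] using (Asymptotics.isLittleO_pow_id one_lt_two).comp_tendsto h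
  · refine LipschitzWith.of_dist_le_mul fun t s => ?_
    rw [Real.coe_toNNReal _ hC, Real.dist_eq, Real.dist_eq]
    exact le_of_tendsto ((hW t).sub (hW s)).abs ((hdom s t).mono fun n hn => hlip n s t hn)
  · exact le_of_tendsto (hX t).abs ((hdom t t).mono fun n hn => hx n t (hn left_mem_uIcc))

/-- The accelerations `a n` need not converge. Their bound near `t` becomes one on increments of `v
n`, which passes to `W`; then `s → t` and `η → 0`. -/
theorem abs_deriv_sub_le_of_tendsto {ι : Type*} {U : Filter ι} [U.NeBot] {v a : ι → ℝ → ℝ}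
    {W : ℝ → ℝ} {t b c ρ : ℝ} (hW : ∀ s, Tendsto (v · s) U (𝓝 (W s))) (hb : HasDerivAt W b t)
    (h : ∀ η > 0, ∃ δ > 0, ∀ᶠ n in U, ∀ s, |s - t| ≤ δ →
      HasDerivAt (v n) (a n s) s ∧ |a n s - c| ≤ ρ + η) :
    |b - c| ≤ ρ := by
  refine le_of_forall_pos_le_add fun η hη => ?_
  obtain ⟨δ, hδ, hn⟩ := h η hη
  have key : ∀ s, |s - t| ≤ δ → |W s - W t - c * (s - t)| ≤ (ρ + η) * |s - t| := by
    intro s hs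
    refine le_of_tendsto (((hW s).sub (hW t)).sub_const (c * (s - t))).abs ?_
    filter_upwards [hn] with n hn
    have hr : ∀ r ∈ uIcc t s, |r - t| ≤ δ := fun r hr => (abs_sub_left_of_mem_uIcc hr).trans hs
    have h := (convex_uIcc t s).norm_image_sub_le_of_norm_hasDerivWithin_le (C := ρ + η)
      (f := fun r => v n r - c * r) (f' := fun r => a n r - c)
      (fun r hr' => ((hn r (hr r hr')).1.sub
        ((hasDerivAt_id r).const_mul c)).hasDerivWithinAt.congr_deriv (by simp))
      (fun r hr' => (hn r (hr r hr')).2) left_mem_uIcc right_mem_uIcc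
    simp only [Real.norm_eq_abs] at h
    exact (le_of_eq (congrArg abs (by ring))).trans h
  have hs := ((hasDerivAt_iff_tendsto_slope.1 hb).sub_const c).abs
  refine le_of_tendsto hs ?_
  have hnear : ∀ᶠ s in 𝓝[≠] t, |s - t| ≤ δ :=
    nhdsWithin_le_nhds (by simpa [Real.dist_eq] using! Metric.closedBall_mem_nhds t hδ)
  filter_upwards [hnear, self_mem_nhdsWithin] with s hs hst
  have hst' : s - t ≠ 0 := sub_ne_zero.2 hst
  rw [slope_def_field, show (W s - W t) / (s - t) - c = (W s - W t - c * (s - t)) / (s - t) by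
    field_simp, abs_div, div_le_iff₀ (abs_pos.2 hst')]
  exact key s hs

/-! ### The wheel angle and the Filippov set -/

theorem continuous_wheelAngle {ω : ℝ → ℝ} (hω : ContDiff ℝ 1 ω) (t₀ : ℝ) :
    Continuous (wheelAngle ω t₀) :=
  intervalIntegral.continuous_primitive (fun a b => hω.continuous.intervalIntegrable a b) t₀

theorem exists_mem_diff_of_measure_eq_zero {U N : Set ℝ} (hU : IsOpen U) (hne : U.Nonempty)
    (hN : volume N = 0) : (U \ N).Nonempty := by
  rw [sdiff_nonempty]
  exact fun h => (hU.measure_pos volume hne).ne' (measure_mono_null h hN)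

theorem convex_filippovSet (f : ℝ → ℝ → ℝ → ℝ) (t x v : ℝ) : Convex ℝ (filippovSet f t x v) :=
  convex_iInter fun _ => convex_iInter fun _ => convex_iInter fun _ => convex_iInter fun _ =>
    convex_closedConvexHull

/-- Every ball around `v` meets `S` in a nonempty open set, which no null set can cover, so the
value `a` survives the removal of `N`. -/
theorem mem_filippovSet_of_eqOn {f : ℝ → ℝ → ℝ → ℝ} {t x v a : ℝ} {S : Set ℝ} (hS : IsOpen S)
    (hv : v ∈ closure S) (h : ∀ w ∈ S, f t x w = a) : a ∈ filippovSet f t x v := by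
  simp only [filippovSet, mem_iInter]
  intro r hr N hN
  obtain ⟨w, ⟨hw, hwS⟩, hwN⟩ := exists_mem_diff_of_measure_eq_zero
    (Metric.isOpen_ball.inter hS)
    (mem_closure_iff.1 hv _ Metric.isOpen_ball (Metric.mem_ball_self hr)) hN
  exact subset_closedConvexHull ⟨w, ⟨hw, hwN⟩, h w hwS⟩

/-- On `w > 0` the force does not depend on `w`. The case `v = 0` is included, so there this lemma
and its mirror image give both ends of the friction interval. -/
theorem sub_mem_filippovSet_pendulumForce (ω : ℝ → ℝ) (t₀ : ℝ) (K : ℝ → ℝ) {t x v : ℝ}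
    (hv : 0 ≤ v) :
    sin (x + wheelAngle ω t₀ t) - deriv ω t - K x
      ∈ filippovSet (pendulumForce ω t₀ K) t x v := by
  refine mem_filippovSet_of_eqOn isOpen_Ioi (by rwa [closure_Ioi]) fun w (hw : 0 < w) => ?_
  rw [pendulumForce, abs_of_pos hw, div_self hw.ne']
  ring

theorem add_mem_filippovSet_pendulumForce (ω : ℝ → ℝ) (t₀ : ℝ) (K : ℝ → ℝ) {t x v : ℝ}
    (hv : v ≤ 0) :
    sin (x + wheelAngle ω t₀ t) - deriv ω t + K x
      ∈ filippovSet (pendulumForce ω t₀ K) t x v := by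
  refine mem_filippovSet_of_eqOn isOpen_Iio (by rwa [closure_Iio]) fun w (hw : w < 0) => ?_
  rw [pendulumForce, abs_of_neg hw, div_neg, div_self hw.ne]
  ring

/-! ### The regularized pendulum -/

theorem exists_regularized_pendulum_solution {ω : ℝ → ℝ} (hω : ContDiff ℝ 1 ω) (t₀ : ℝ)
    {K : ℝ → ℝ} (hK : ContDiff ℝ 1 K) (hKnonneg : ∀ x, 0 ≤ K x) {Kstar Φstar ε ψstar : ℝ}
    (hKstar : ∀ x : ℝ, K x ≤ Kstar) (hΦ : ∀ t : ℝ, |wheelAngle ω t₀ t| ≤ Φstar)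
    (hε : ∀ t : ℝ, |deriv ω t| ≤ ε) (hψ : 0 ≤ ψstar) (h₁ : ψstar + Φstar ≤ π / 2)
    (h₂ : Kstar + ε < sin (ψstar - Φstar)) {k T : ℝ} (hk : 0 ≤ k) (hT : 0 < T) :
    ∃ x v : ℝ → ℝ, ∀ t ∈ Ioo (-T) T, HasDerivAt x (v t) t ∧
      HasDerivAt v (sin (x t + wheelAngle ω t₀ t) - deriv ω t - K (x t) * clamp 1 (k * v t)) t ∧
      |x t| ≤ ψstar := by
  have hK0 : 0 ≤ Kstar := (hKnonneg 0).trans (hKstar 0)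
  obtain ⟨L, hL⟩ := hK.contDiffOn.exists_lipschitzOnWith one_ne_zero
    (convex_Icc (-ψstar) ψstar) isCompact_Icc
  have hmem : ∀ x, clamp ψstar x ∈ Icc (-ψstar) ψstar := fun x => abs_le.1 (abs_clamp_le hψ x)
  have hone : ∀ y, |clamp 1 y| ≤ 1 := abs_clamp_le zero_le_one
  obtain ⟨x, v, hx0, hx1, hxc, hd⟩ := exists_dirichlet_solution (T := T)
    (f := fun t x v => sin (clamp ψstar x + wheelAngle ω t₀ t) - deriv ω t
      - K (clamp ψstar x) * clamp 1 (k * v)) (C := 1 + ε + Kstar) (L := 1 + L + Kstar * k) hT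
    (by positivity)
    (by
      intro t x v
      refine (abs_sub _ _).trans (add_le_add ((abs_sub _ _).trans
        (add_le_add (abs_sin_le_one _) (hε t))) ?_)
      rw [abs_mul, abs_of_nonneg (hKnonneg _)]
      exact (mul_le_of_le_one_right (hKnonneg _) (hone _)).trans (hKstar _))
    (by
      intro x v
      have := continuous_wheelAngle hω t₀
      have := (contDiff_one_iff_deriv.1 hω).2
      fun_prop)
    (by
      intro t x y v w
      have hc : |clamp ψstar x - clamp ψstar y| ≤ |x - y| := abs_clamp_sub_clamp_le _ _ _
      have h1 : |sin (clamp ψstar x + wheelAngle ω t₀ t) - sin (clamp ψstar y + wheelAngle ω t₀ t)|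
          ≤ |x - y| := (abs_sin_sub_sin_le _ _).trans (by simpa using hc)
      have h2 : |K (clamp ψstar x) - K (clamp ψstar y)| ≤ L * |x - y| :=
        (hL.dist_le_mul _ (hmem x) _ (hmem y)).trans (mul_le_mul_of_nonneg_left hc L.2)
      have h3 : |clamp 1 (k * v) - clamp 1 (k * w)| ≤ k * |v - w| :=
        (abs_clamp_sub_clamp_le _ _ _).trans_eq (by rw [← mul_sub, abs_mul, abs_of_nonneg hk])
      have h4 : |(K (clamp ψstar x) - K (clamp ψstar y)) * clamp 1 (k * v)| ≤ L * |x - y| := by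
        rw [abs_mul]
        exact (mul_le_of_le_one_right (abs_nonneg _) (hone _)).trans h2
      have h5 : |K (clamp ψstar y) * (clamp 1 (k * v) - clamp 1 (k * w))| ≤ Kstar * (k * |v - w|) := by
        rw [abs_mul, abs_of_nonneg (hKnonneg _)]
        exact mul_le_mul (hKstar _) h3 (abs_nonneg _) hK0
      have h6 : 0 ≤ |x - y| := abs_nonneg _
      have h7 : 0 ≤ |v - w| := abs_nonneg _
      have h8 : 0 ≤ Kstar * k := by positivity
      have h9 : (0 : ℝ) ≤ L := L.2
      calc _ = |(sin (clamp ψstar x + wheelAngle ω t₀ t) - sin (clamp ψstar y + wheelAngle ω t₀ t))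
            - (K (clamp ψstar x) - K (clamp ψstar y)) * clamp 1 (k * v)
            - K (clamp ψstar y) * (clamp 1 (k * v) - clamp 1 (k * w))| := congrArg abs (by ring)
        _ ≤ |x - y| + L * |x - y| + Kstar * (k * |v - w|) :=
          (abs_sub _ _).trans (add_le_add ((abs_sub _ _).trans (add_le_add h1 h4)) h5)
        _ ≤ _ := by nlinarith [mul_nonneg h8 h6, mul_nonneg h9 h7])
  have hzero : clamp 1 0 = 0 := clamp_of_abs_le (by simp)
  have hup : ∀ t ∈ Icc (-T) T, x t ≤ ψstar := by
    refine le_of_deriv_pos_at_critical hψ hx0 hx1 hxc hd fun t ht hxt hvt => ?_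
    have hm := abs_le.1 (hΦ t)
    -- Both angles lie in `[-π/2, π/2]`, where `sin` increases; the truncation fixes the position at
    -- `ψstar` for any overshoot.
    have := sin_le_sin_of_le_of_le_pi_div_two (x := ψstar - Φstar)
      (y := ψstar + wheelAngle ω t₀ t) (by linarith) (by linarith) (by linarith)
    simp only [hvt, mul_zero, hzero, sub_zero, clamp_of_le hψ hxt.le]
    linarith [(abs_le.1 (hε t)).2]
  -- The maximum principle for `-x`, using that `sin` is odd.
  have hlo : ∀ t ∈ Icc (-T) T, -x t ≤ ψstar := by
    refine le_of_deriv_pos_at_critical (x := fun t => -x t) (v := fun t => -v t) hψ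
      (by simp [hx0]) (by simp [hx1]) hxc.neg
      (fun t ht => ⟨(hd t ht).1.neg, (hd t ht).2.neg⟩) fun t ht hxt hvt => ?_
    have hm := abs_le.1 (hΦ t)
    have := sin_le_sin_of_le_of_le_pi_div_two (x := ψstar - Φstar)
      (y := ψstar - wheelAngle ω t₀ t) (by linarith) (by linarith) (by linarith)
    simp only [neg_eq_zero.1 hvt, mul_zero, hzero, sub_zero,
      clamp_of_le_neg hψ (show x t ≤ -ψstar by linarith)]
    rw [show -ψstar + wheelAngle ω t₀ t = -(ψstar - wheelAngle ω t₀ t) by ring, sin_neg]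
    linarith [(abs_le.1 (hε t)).1]
  refine ⟨x, v, fun t ht => ?_⟩
  have hxt : |x t| ≤ ψstar := abs_le'.2
    ⟨hup t (Ioo_subset_Icc_self ht), hlo t (Ioo_subset_Icc_self ht)⟩
  have h := (hd t ht).2
  rw [clamp_of_abs_le hxt] at h
  exact ⟨(hd t ht).1, h, hxt⟩

/-! ### Passage to the limit -/

theorem exists_forall_abs_sub_lt_of_deriv_le {U : Filter ℕ} (hU : U ≤ atTop)
    {u u' : ℕ → ℝ → ℝ} {B t l : ℝ}
    (hd : ∀ n : ℕ, ∀ s ∈ Ioo (-(n + 2 : ℝ)) (n + 2), HasDerivAt (u n) (u' n s) s)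
    (hB : ∀ n : ℕ, ∀ s ∈ Ioo (-(n + 2 : ℝ)) (n + 2), |u' n s| ≤ B)
    (hl : Tendsto (u · t) U (𝓝 l)) {γ : ℝ} (hγ : 0 < γ) :
    ∃ δ > 0, ∀ᶠ n in U, ∀ s, |s - t| ≤ δ → |u n s - l| < γ := by
  have hB0 : 0 ≤ B := (abs_nonneg _).trans (hB 0 0 (by norm_num))
  -- The `1` keeps `s` in the window eventually covered by the domains; `B + 1` avoids division by
  -- zero.
  refine ⟨min 1 (γ / (2 * (B + 1))), by positivity, ?_⟩
  filter_upwards [hU (eventually_Icc_subset_Ioo_natCast t),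
    hl.eventually (Metric.ball_mem_nhds l (half_pos hγ))] with n hn hnl s hs
  have hs1 : s ∈ Icc (t - 1) (t + 1) := by
    have := abs_le.1 (hs.trans (min_le_left _ _))
    exact ⟨by linarith, by linarith⟩
  have h := (convex_Icc (t - 1) (t + 1)).norm_image_sub_le_of_norm_hasDerivWithin_le
    (fun r hr => (hd n r (hn hr)).hasDerivWithinAt) (fun r hr => hB n r (hn hr))
    (show t ∈ Icc (t - 1) (t + 1) from ⟨by linarith, by linarith⟩) hs1
  simp only [Real.norm_eq_abs] at h
  have hs2 : (B + 1) * |s - t| ≤ γ / 2 := by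
    have := hs.trans (min_le_right _ _)
    rw [le_div_iff₀ (by positivity)] at this
    linarith
  have hnl' : |u n t - l| < γ / 2 := hnl
  have := abs_sub_le (u n s) (u n t) l
  linarith [abs_nonneg (s - t)]

theorem theorem4p2
    (ω : ℝ → ℝ) (hω : ContDiff ℝ 1 ω) (t₀ : ℝ)
    (K : ℝ → ℝ) (hK : ContDiff ℝ 2 K) (hKper : Function.Periodic K (2 * π))
    (hKnonneg : ∀ x : ℝ, 0 ≤ K x)
    (Kstar Φstar ε : ℝ)
    (hKstar : ∀ x : ℝ, K x ≤ Kstar)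
    (hΦ : ∀ t : ℝ, |wheelAngle ω t₀ t| ≤ Φstar)
    (hε : ∀ t : ℝ, |deriv ω t| ≤ ε)
    (ψstar : ℝ) (hψ : 0 ≤ ψstar)
    (h₁ : ψstar + Φstar ≤ π / 2)
    (h₂ : Kstar + ε < sin (ψstar - Φstar)) :
    ∃ ψ : ℝ → ℝ,
      IsGeneralizedSolution (pendulumForce ω t₀ K) Set.univ ψ ∧
      (∀ t : ℝ, |ψ t| ≤ ψstar) ∧
      (∀ t : ℝ, |ψ t + wheelAngle ω t₀ t| ≤ ψstar + Φstar) := by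
  choose x v hxv using fun n : ℕ => exists_regularized_pendulum_solution hω t₀
    (hK.of_le one_le_two) hKnonneg hKstar hΦ hε hψ h₁ h₂ (Nat.cast_nonneg n)
    -- Half-length `n + 2` exceeds one even for `n = 0`, as the velocity bound requires.
    (show (0 : ℝ) < n + 2 by positivity)
  have hone : ∀ y, |clamp 1 y| ≤ 1 := abs_clamp_le zero_le_one
  let p : ℝ → ℝ → ℝ := fun y s => sin (y + wheelAngle ω t₀ s) - deriv ω s
  let a : ℕ → ℝ → ℝ := fun n s => p (x n s) s - K (x n s) * clamp 1 (n * v n s)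
  have hd : ∀ n : ℕ, ∀ t ∈ Ioo (-(n + 2 : ℝ)) (n + 2),
      HasDerivAt (x n) (v n t) t ∧ HasDerivAt (v n) (a n t) t :=
    fun n t ht => ⟨(hxv n t ht).1, (hxv n t ht).2.1⟩
  have hxb : ∀ n : ℕ, ∀ t ∈ Ioo (-(n + 2 : ℝ)) (n + 2), |x n t| ≤ ψstar :=
    fun n t ht => (hxv n t ht).2.2
  have hfric : ∀ n s, |K (x n s) * clamp 1 (n * v n s)| ≤ K (x n s) := fun n s => by
    rw [abs_mul, abs_of_nonneg (hKnonneg _)]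
    exact mul_le_of_le_one_right (hKnonneg _) (hone _)
  have hab : ∀ n : ℕ, ∀ t ∈ Ioo (-(n + 2 : ℝ)) (n + 2), |a n t| ≤ 1 + ε + Kstar := fun n t _ =>
    (abs_sub _ _).trans (add_le_add ((abs_sub _ _).trans
      (add_le_add (abs_sin_le_one _) (hε t))) ((hfric n t).trans (hKstar _)))
  have hvb : ∀ n : ℕ, ∀ t ∈ Ioo (-(n + 2 : ℝ)) (n + 2), |v n t| ≤ 2 * ψstar + (1 + ε + Kstar) :=
    fun n => abs_deriv_le_of_abs_le (by linarith [n.cast_nonneg (α := ℝ)]) (hd n) (hxb n) (hab n)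
  obtain ⟨U, X, W, hU, hX, hW, hXW, hLip, hXb⟩ := exists_ultrafilter_limit_of_bounded hd hxb hvb hab
  have hderiv : deriv X = W := funext fun t => (hXW t).deriv
  refine ⟨X, ⟨isOpen_univ, ordConnected_univ, ?_, ?_, ?_⟩, hXb, fun t =>
    (abs_add_le _ _).trans (add_le_add (hXb t) (hΦ t))⟩
  · exact (contDiff_one_iff_deriv.2
      ⟨fun t => (hXW t).differentiableAt, hderiv ▸ hLip.continuous⟩).contDiffOn
  · exact fun _ _ _ => hderiv ▸ hLip.lipschitzOnWith.absolutelyContinuousOnInterval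
  · rw [hderiv]
    filter_upwards [hLip.ae_differentiableAt_real] with t ht _
    refine ⟨deriv W t, ht.hasDerivAt, ?_⟩
    have hp : Continuous fun q : ℝ × ℝ => p q.1 q.2 := by
      have := continuous_wheelAngle hω t₀
      have := (contDiff_one_iff_deriv.1 hω).2
      fun_prop
    have hnear : ∀ η > 0, ∀ γ > 0, ∃ δ > 0, ∀ᶠ n in (U : Filter ℕ), ∀ s, |s - t| ≤ δ →
        HasDerivAt (v n) (a n s) s ∧ |p (x n s) s - p (X t) t| ≤ η ∧
          |K (x n s) - K (X t)| ≤ η ∧ |v n s - W t| < γ := by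
      intro η hη γ hγ
      obtain ⟨γ₁, hγ₁, hp1⟩ := Metric.continuousAt_iff.1 (hp.continuousAt (x := (X t, t))) η hη
      obtain ⟨γ₂, hγ₂, hK2⟩ := Metric.continuousAt_iff.1 (hK.continuous.continuousAt (x := X t)) η hη
      obtain ⟨δ₁, hδ₁, hδx⟩ := exists_forall_abs_sub_lt_of_deriv_le hU (fun n s hs => (hd n s hs).1)
        hvb (hX t) (lt_min hγ₁ hγ₂)
      obtain ⟨δ₂, hδ₂, hδv⟩ := exists_forall_abs_sub_lt_of_deriv_le hU (fun n s hs => (hd n s hs).2)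
        hab (hW t) hγ
      refine ⟨min (min δ₁ δ₂) (min 1 (γ₁ / 2)), by positivity, ?_⟩
      filter_upwards [hδx, hδv, hU (eventually_Icc_subset_Ioo_natCast t)] with n h1 h2 h3 s hs
      simp only [le_min_iff] at hs
      obtain ⟨⟨hs1, hs2⟩, hs3, hs4⟩ := hs
      have hx' := lt_min_iff.1 (h1 s hs1)
      have hs5 := abs_le.1 hs3
      refine ⟨(hd n s (h3 ⟨by linarith, by linarith⟩)).2, (hp1 (x := (x n s, s)) ?_).le,
        (hK2 hx'.2).le, h2 s hs2⟩
      exact max_lt hx'.1 (hs4.trans_lt (half_lt_self hγ₁))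
    have hlarge : ∀ c : ℝ, 0 < c → ∀ᶠ n : ℕ in (U : Filter ℕ), 1 ≤ n * c := fun c hc =>
      hU (((tendsto_natCast_atTop_atTop (R := ℝ)).atTop_mul_const hc).eventually_ge_atTop 1)
    -- If `W t ≠ 0`, the nearby `v n` keep its sign and at least half its size, so the ramp
    -- saturates at `±1` for large `n` and the limit force is exact. If `W t = 0`, friction is only
    -- known to be at most `K` in size, and convexity of the Filippov set covers that whole
    -- interval.
    rcases lt_trichotomy (W t) 0 with hneg | hzero | hpos
    · have h : |deriv W t - (p (X t) t + K (X t))| ≤ 0 := by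
        refine abs_deriv_sub_le_of_tendsto (a := a) hW ht.hasDerivAt fun η hη => ?_
        obtain ⟨δ, hδ, h⟩ := hnear (η / 2) (half_pos hη) (-W t / 2) (by linarith)
        refine ⟨δ, hδ, ?_⟩
        filter_upwards [h, hlarge (-W t / 2) (by linarith)] with n h hn s hs
        obtain ⟨h1, h2, h3, h4⟩ := h s hs
        refine ⟨h1, ?_⟩
        have h5 : n * v n s ≤ -1 := by
          nlinarith [(abs_lt.1 h4).2, n.cast_nonneg (α := ℝ)]
        simp only [a, clamp_of_le_neg zero_le_one h5]
        rw [abs_le] at *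
        constructor <;> linarith
      rw [sub_eq_zero.1 (abs_nonpos_iff.1 h)]
      exact add_mem_filippovSet_pendulumForce ω t₀ K hneg.le
    · have h : |deriv W t - p (X t) t| ≤ K (X t) := by
        refine abs_deriv_sub_le_of_tendsto (a := a) hW ht.hasDerivAt fun η hη => ?_
        obtain ⟨δ, hδ, h⟩ := hnear (η / 2) (half_pos hη) 1 one_pos
        refine ⟨δ, hδ, h.mono fun n h s hs => ?_⟩
        obtain ⟨h1, h2, h3, -⟩ := h s hs
        have h4 := hfric n s
        refine ⟨h1, ?_⟩
        simp only [a]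
        rw [abs_le] at *
        constructor <;> linarith
      have h := abs_le.1 h
      exact (convex_filippovSet _ _ _ _).ordConnected.out
        (sub_mem_filippovSet_pendulumForce ω t₀ K hzero.ge)
        (add_mem_filippovSet_pendulumForce ω t₀ K hzero.le)
        ⟨by linarith [h.1], by linarith [h.2]⟩
    · have h : |deriv W t - (p (X t) t - K (X t))| ≤ 0 := by
        refine abs_deriv_sub_le_of_tendsto (a := a) hW ht.hasDerivAt fun η hη => ?_
        obtain ⟨δ, hδ, h⟩ := hnear (η / 2) (half_pos hη) (W t / 2) (by linarith)
        refine ⟨δ, hδ, ?_⟩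
        filter_upwards [h, hlarge (W t / 2) (by linarith)] with n h hn s hs
        obtain ⟨h1, h2, h3, h4⟩ := h s hs
        refine ⟨h1, ?_⟩
        have h5 : 1 ≤ n * v n s := by
          nlinarith [(abs_lt.1 h4).1, n.cast_nonneg (α := ℝ)]
        simp only [a, clamp_of_le zero_le_one h5]
        rw [abs_le] at *
        constructor <;> linarith
      rw [sub_eq_zero.1 (abs_nonpos_iff.1 h)]
      exact sub_mem_filippovSet_pendulumForce ω t₀ K hpos.le
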